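/- **Setting.** Let $(\Omega,\mathcal F,\mu)$ be a $\sigma$-finite measure space. Identify sets in $\mathcal F$ that differ by a null set; the quotient is a complete Boolean algebra, and below all (possibly uncountable) unions, intersections and complements of elements of $\mathcal F$ are taken in it. Let $L^0(\mathbb N)$ be the set of measurable functions $\Omega\to\mathbb N=\{0,1,\dots\}$ modulo almost everywhere equality, with pointwise $+,\cdot,0,1$. For $n\in L^0(\mathbb N)$ and $A\in\mathcal F$ let $n|A$ be the restriction of $n$ to $A$, and for $N\subset L^0(\mathbb N)$ let $N|A=\{n|A : n\in N\}$. Call $N\subset L^0(\mathbb N)$ *stable* if it is non-empty and, for every countable measurable partition $(A_k)$ of $\Omega$ and all $n_k\in N$, the element $x\in L^0(\mathbb N)$ with $x|A_k=n_k|A_k$ for all $k$ lies in $N$. The conditional power set is $\mathcal P=\{N|A : N\subset L^0(\mathbb N)\text{ stable},\ A\in\mathcal F\}$, and the conditional element relation is $$i(n,N|A)=\bigcup\{A'\in\mathcal F : A'\subset A,\ n|A'\in N|A'\}\in\mathcal F .$$ Let $\mathcal S=(L^0(\mathbb N),\mathcal P,+,\cdot,0,1,<,i)$. **Evaluation.**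 A conditional assignment $\beta$ maps the number variables of the language $L_2$ of second-order arithmetic to $L^0(\mathbb N)$ and the set variables to $\mathcal P$. Terms are evaluated by the operations of $L^0(\mathbb N)$. Formulas are evaluated in $\mathcal F$ by $[s=t]^\beta=\{\omega: [s]^\beta(\omega)=[t]^\beta(\omega)\}$, $[s<t]^\beta=\{\omega: [s]^\beta(\omega)<[t]^\beta(\omega)\}$, $[t\in X]^\beta=i([t]^\beta,\beta(X))$; the connectives $\neg,\wedge,\vee,\to$ are interpreted by the Boolean operations of $\mathcal F$ (with $[\phi\to\psi]^\beta=([\phi]^\beta)^c\cup[\psi]^\beta$), and $\exists,\forall$ by the union, respectively the intersection, of the values over all elements of $L^0(\mathbb N)$ (number quantifiers) or of $\mathcal P$ (set quantifiers). **The theory.** $\mathrm{ACA}_0$ consists of the universal closures of the basic axioms $x+1\ne0$; $x+1=y+1\to x=y$; $x+0=x$; $x+(y+1)=(x+y)+1$; $x\cdot0=0$; $x\cdot(y+1)=(x\cdot y)+x$; $\neg\,x<0$; $x<y+1\leftrightarrow(x<y\vee x=y)$; of the induction axiom $(0\in X\wedge\forall x(x\in X\to x+1\in X))\to\forall x(x\in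 X)$; and of $\exists X\forall x(x\in X\leftrightarrow\phi(x))$ for every formula $\phi$ without set quantifiers (number and set parameters allowed) in which $X$ is not free. A formula $\phi$ of $L_2$ is a consequence of $\mathrm{ACA}_0$ if for some finite list $\Gamma$ of axioms of $\mathrm{ACA}_0$ the sequent $\Gamma\rightarrow\phi$ is derivable in the classical sequent calculus of second-order logic with equality between numbers, in which set quantifiers are instantiated by set variables only. **Theorem (transfer principle).** If a formula $\phi$ of $L_2$ is a consequence of $\mathrm{ACA}_0$, then $\phi$ holds in $\mathcal S$ with truth value $\Omega$, that is, $[\phi]^\beta=\Omega$ in $\mathcal F$ modulo null sets for every conditional assignment $\beta$. -/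

import Mathlib

open MeasureTheory

namespace CondArith

/-! ## The language of second-order arithmetic

Number variables and set variables are two independent families indexed by `ℕ`; bound variables are
de Bruijn indices, so a quantifier binds the variable `0` of its sort. -/

/-- First-order terms. -/
inductive Term : Type
  | var : ℕ → Term
  | zero : Term
  | one : Term
  | add : Term → Term → Term
  | mul : Term → Term → Term

/-- Formulas; `mem t X` is `t ∈ X`, `allN`/`exN` quantify over numbers, `allS`/`exS` over sets. -/
inductive Formula : Type
  | eq : Term → Term → Formula
  | lt : Term → Term → Formula
  | mem : Term → ℕ → Formula
  | neg : Formula → Formula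
  | and : Formula → Formula → Formula
  | or : Formula → Formula → Formula
  | imp : Formula → Formula → Formula
  | allN : Formula → Formula
  | exN : Formula → Formula
  | allS : Formula → Formula
  | exS : Formula → Formula

/-- Put `a` in front of a sequence. -/
def cons {α : Type*} (a : α) (f : ℕ → α) : ℕ → α
  | 0 => a
  | k + 1 => f k

namespace Term

/-- Simultaneous substitution of terms for number variables. -/
def subst (σ : ℕ → Term) : Term → Term
  | var k => σ k
  | zero => zero
  | one => one
  | add s t => add (s.subst σ) (t.subst σ)
  | mul s t => mul (s.subst σ) (t.subst σ)

/-- Raise all number variables by one. -/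
def shift (t : Term) : Term := t.subst fun k => var (k + 1)

end Term

namespace Formula

/-- Simultaneous (capture-avoiding) substitution of terms `σ` for number variables and of set
variables `τ` for set variables. -/
def subst : Formula → (ℕ → Term) → (ℕ → ℕ) → Formula
  | eq s t, σ, _ => eq (s.subst σ) (t.subst σ)
  | lt s t, σ, _ => lt (s.subst σ) (t.subst σ)
  | mem t X, σ, τ => mem (t.subst σ) (τ X)
  | neg φ, σ, τ => neg (φ.subst σ τ)
  | and φ ψ, σ, τ => and (φ.subst σ τ) (ψ.subst σ τ)
  | or φ ψ, σ, τ => or (φ.subst σ τ) (ψ.subst σ τ)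
  | imp φ ψ, σ, τ => imp (φ.subst σ τ) (ψ.subst σ τ)
  | allN φ, σ, τ => allN (φ.subst (cons (.var 0) fun k => (σ k).shift) τ)
  | exN φ, σ, τ => exN (φ.subst (cons (.var 0) fun k => (σ k).shift) τ)
  | allS φ, σ, τ => allS (φ.subst σ (cons 0 fun k => τ k + 1))
  | exS φ, σ, τ => exS (φ.subst σ (cons 0 fun k => τ k + 1))

/-- `φ(t)`: replace the number variable `0` by `t` and lower the other number variables. -/
def instN (φ : Formula) (t : Term) : Formula := φ.subst (cons t .var) id

/-- `φ(Y)`: replace the set variable `0` by `Y` and lower the other set variables. -/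
def instS (φ : Formula) (Y : ℕ) : Formula := φ.subst .var (cons Y id)

/-- Raise all free number variables by one, so that the number variable `0` is not free. -/
def shiftN (φ : Formula) : Formula := φ.subst (fun k => .var (k + 1)) id

/-- Raise all free set variables by one, so that the set variable `0` is not free. -/
def shiftS (φ : Formula) : Formula := φ.subst .var Nat.succ

/-- `φ ↔ ψ`. -/
def iff (φ ψ : Formula) : Formula := and (imp φ ψ) (imp ψ φ)

/-- Arithmetical formulas: no set quantifiers; set variables may occur free. -/
def Arithmetical : Formula → Prop
  | eq _ _ | lt _ _ | mem _ _ => True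
  | neg φ | allN φ | exN φ => φ.Arithmetical
  | and φ ψ | or φ ψ | imp φ ψ => φ.Arithmetical ∧ ψ.Arithmetical
  | allS _ | exS _ => False

end Formula

/-! ## Sequent calculus for second-order logic with equality -/

open Formula in
/-- Derivability of the sequent `Γ → Δ` in the classical sequent calculus with the number terms, the
set variables and the equality relation. In the rules with an eigenvariable (`allNR`, `exNL`,
`allSR`, `exSL`) the eigenvariable is the variable `0` of the premise, which does not occur in the
raised side formulas. -/
inductive Derivable : List Formula → List Formula → Prop
  -- initial sequents
  | init (φ : Formula) : Derivable [φ] [φ]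
  | eqRefl (t : Term) : Derivable [] [eq t t]
  | eqAdd (s s' t t' : Term) :
      Derivable [eq s s', eq t t'] [eq (.add s t) (.add s' t')]
  | eqMul (s s' t t' : Term) :
      Derivable [eq s s', eq t t'] [eq (.mul s t) (.mul s' t')]
  | eqEq (s s' t t' : Term) : Derivable [eq s s', eq t t', eq s t] [eq s' t']
  | eqLt (s s' t t' : Term) : Derivable [eq s s', eq t t', lt s t] [lt s' t']
  | eqMem (s s' : Term) (X : ℕ) : Derivable [eq s s', mem s X] [mem s' X]
  -- structural rules
  | weakL {Γ Δ : List Formula} (φ : Formula) : Derivable Γ Δ → Derivable (φ :: Γ) Δ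
  | weakR {Γ Δ : List Formula} (φ : Formula) : Derivable Γ Δ → Derivable Γ (φ :: Δ)
  | contrL {Γ Δ : List Formula} {φ : Formula} :
      Derivable (φ :: φ :: Γ) Δ → Derivable (φ :: Γ) Δ
  | contrR {Γ Δ : List Formula} {φ : Formula} :
      Derivable Γ (φ :: φ :: Δ) → Derivable Γ (φ :: Δ)
  | exchL {Γ Γ' Δ : List Formula} : Γ.Perm Γ' → Derivable Γ Δ → Derivable Γ' Δ
  | exchR {Γ Δ Δ' : List Formula} : Δ.Perm Δ' → Derivable Γ Δ → Derivable Γ Δ'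
  | cut {Γ Δ Γ' Δ' : List Formula} {φ : Formula} :
      Derivable Γ (φ :: Δ) → Derivable (φ :: Γ') Δ' → Derivable (Γ ++ Γ') (Δ ++ Δ')
  -- propositional rules
  | negL {Γ Δ : List Formula} {φ : Formula} : Derivable Γ (φ :: Δ) → Derivable (neg φ :: Γ) Δ
  | negR {Γ Δ : List Formula} {φ : Formula} : Derivable (φ :: Γ) Δ → Derivable Γ (neg φ :: Δ)
  | andL₁ {Γ Δ : List Formula} {φ : Formula} (ψ : Formula) :
      Derivable (φ :: Γ) Δ → Derivable (and φ ψ :: Γ) Δ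
  | andL₂ {Γ Δ : List Formula} (φ : Formula) {ψ : Formula} :
      Derivable (ψ :: Γ) Δ → Derivable (and φ ψ :: Γ) Δ
  | andR {Γ Δ : List Formula} {φ ψ : Formula} :
      Derivable Γ (φ :: Δ) → Derivable Γ (ψ :: Δ) → Derivable Γ (and φ ψ :: Δ)
  | orL {Γ Δ : List Formula} {φ ψ : Formula} :
      Derivable (φ :: Γ) Δ → Derivable (ψ :: Γ) Δ → Derivable (or φ ψ :: Γ) Δ
  | orR₁ {Γ Δ : List Formula} {φ : Formula} (ψ : Formula) :
      Derivable Γ (φ :: Δ) → Derivable Γ (or φ ψ :: Δ)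
  | orR₂ {Γ Δ : List Formula} (φ : Formula) {ψ : Formula} :
      Derivable Γ (ψ :: Δ) → Derivable Γ (or φ ψ :: Δ)
  | impL {Γ Δ Γ' Δ' : List Formula} {φ ψ : Formula} :
      Derivable Γ (φ :: Δ) → Derivable (ψ :: Γ') Δ' →
        Derivable (imp φ ψ :: (Γ ++ Γ')) (Δ ++ Δ')
  | impR {Γ Δ : List Formula} {φ ψ : Formula} :
      Derivable (φ :: Γ) (ψ :: Δ) → Derivable Γ (imp φ ψ :: Δ)
  -- number quantifiers
  | allNL {Γ Δ : List Formula} {φ : Formula} (t : Term) :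
      Derivable (φ.instN t :: Γ) Δ → Derivable (allN φ :: Γ) Δ
  | allNR {Γ Δ : List Formula} {φ : Formula} :
      Derivable (Γ.map shiftN) (φ :: Δ.map shiftN) → Derivable Γ (allN φ :: Δ)
  | exNL {Γ Δ : List Formula} {φ : Formula} :
      Derivable (φ :: Γ.map shiftN) (Δ.map shiftN) → Derivable (exN φ :: Γ) Δ
  | exNR {Γ Δ : List Formula} {φ : Formula} (t : Term) :
      Derivable Γ (φ.instN t :: Δ) → Derivable Γ (exN φ :: Δ)
  -- set quantifiers
  | allSL {Γ Δ : List Formula} {φ : Formula} (Y : ℕ) :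
      Derivable (φ.instS Y :: Γ) Δ → Derivable (allS φ :: Γ) Δ
  | allSR {Γ Δ : List Formula} {φ : Formula} :
      Derivable (Γ.map shiftS) (φ :: Δ.map shiftS) → Derivable Γ (allS φ :: Δ)
  | exSL {Γ Δ : List Formula} {φ : Formula} :
      Derivable (φ :: Γ.map shiftS) (Δ.map shiftS) → Derivable (exS φ :: Γ) Δ
  | exSR {Γ Δ : List Formula} {φ : Formula} (Y : ℕ) :
      Derivable Γ (φ.instS Y :: Δ) → Derivable Γ (exS φ :: Δ)

/-- `φ` is a consequence of the theory `T`: some sequent `Γ → φ` with `Γ` a finite list of members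
of `T` is derivable. -/
def Consequence (T : Set Formula) (φ : Formula) : Prop :=
  ∃ Γ : List Formula, (∀ ψ ∈ Γ, ψ ∈ T) ∧ Derivable Γ [φ]

/-! ## The theory `ACA₀` -/

open Formula Term in
/-- The axioms of `ACA₀` as formulas with free variables. -/
inductive ACA0Matrix : Formula → Prop
  /-- `x + 1 ≠ 0` -/
  | succ_ne_zero : ACA0Matrix (neg (eq (add (var 0) one) zero))
  /-- `x + 1 = y + 1 → x = y` -/
  | succ_inj :
      ACA0Matrix (imp (eq (add (var 0) one) (add (var 1) one)) (eq (var 0) (var 1)))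
  /-- `x + 0 = x` -/
  | add_zero : ACA0Matrix (eq (add (var 0) zero) (var 0))
  /-- `x + (y + 1) = (x + y) + 1` -/
  | add_succ :
      ACA0Matrix (eq (add (var 0) (add (var 1) one)) (add (add (var 0) (var 1)) one))
  /-- `x · 0 = 0` -/
  | mul_zero : ACA0Matrix (eq (mul (var 0) zero) zero)
  /-- `x · (y + 1) = (x · y) + x` -/
  | mul_succ :
      ACA0Matrix (eq (mul (var 0) (add (var 1) one)) (add (mul (var 0) (var 1)) (var 0)))
  /-- `¬ x < 0` -/
  | not_lt_zero : ACA0Matrix (neg (lt (var 0) zero))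
  /-- `x < y + 1 ↔ (x < y ∨ x = y)` -/
  | lt_succ :
      ACA0Matrix (iff (lt (var 0) (add (var 1) one))
        (or (lt (var 0) (var 1)) (eq (var 0) (var 1))))
  /-- Induction: `(0 ∈ X ∧ ∀ x (x ∈ X → x + 1 ∈ X)) → ∀ x (x ∈ X)` -/
  | induction :
      ACA0Matrix (imp
        (and (mem zero 0) (allN (imp (mem (var 0) 0) (mem (add (var 0) one) 0))))
        (allN (mem (var 0) 0)))
  /-- Arithmetical comprehension: `∃ X ∀ x (x ∈ X ↔ φ(x))`, `φ` arithmetical (with arbitrary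
  parameters) and `X` not free in `φ`; here `x` is the number variable `0` of `φ`. -/
  | comprehension (φ : Formula) (hφ : φ.Arithmetical) :
      ACA0Matrix (exS (allN (iff (mem (var 0) 0) φ.shiftS)))

/-- The theory `ACA₀`: the formulas above prefixed by any string of universal quantifiers, so in
particular their universal closures (from which all the others are derivable). -/
inductive ACA0 : Set Formula
  | base {φ : Formula} : ACA0Matrix φ → ACA0 φ
  | allN {φ : Formula} : ACA0 φ → ACA0 φ.allN
  | allS {φ : Formula} : ACA0 φ → ACA0 φ.allS

/-! ## The measure algebra -/

variable {Ω : Type*} [MeasurableSpace Ω]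

/-- Two measurable sets are identified if they differ by a null set. -/
def measSetoid (μ : Measure Ω) : Setoid {s : Set Ω // MeasurableSet s} where
  r s t := s.1 =ᵐ[μ] t.1
  iseqv := ⟨fun _ => .rfl, fun h => h.symm, fun h h' => h.trans h'⟩

/-- The measurable sets modulo null sets. -/
def MeasAlg (μ : Measure Ω) : Type _ := Quotient (measSetoid μ)

namespace MeasAlg

variable {μ : Measure Ω}

/-- The class of a measurable set. -/
def mk (μ : Measure Ω) (s : Set Ω) (hs : MeasurableSet s) : MeasAlg μ :=
  Quotient.mk (measSetoid μ) ⟨s, hs⟩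

theorem ind {p : MeasAlg μ → Prop} (h : ∀ s hs, p (mk μ s hs)) (a : MeasAlg μ) : p a :=
  Quotient.inductionOn a fun s => h s.1 s.2

instance : LE (MeasAlg μ) where
  le := Quotient.lift₂ (fun s t => s.1 ≤ᵐ[μ] t.1) fun _ _ _ _ h h' =>
    propext ⟨fun k => (h.symm.le.trans k).trans h'.le, fun k => (h.le.trans k).trans h'.symm.le⟩

theorem mk_le_mk {s t : Set Ω} {hs : MeasurableSet s} {ht : MeasurableSet t} :
    mk μ s hs ≤ mk μ t ht ↔ s ≤ᵐ[μ] t := Iff.rfl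

theorem mk_eq_mk {s t : Set Ω} {hs : MeasurableSet s} {ht : MeasurableSet t} :
    mk μ s hs = mk μ t ht ↔ s =ᵐ[μ] t :=
  ⟨fun h => Quotient.exact h, fun h => Quotient.sound h⟩

instance : PartialOrder (MeasAlg μ) where
  le_refl := ind fun _ _ => mk_le_mk.2 Filter.EventuallyLE.rfl
  le_trans a b c := by
    induction a using ind; induction b using ind; induction c using ind
    exact fun h h' => Filter.EventuallyLE.trans h h'
  le_antisymm a b := by
    induction a using ind; induction b using ind
    exact fun h h' => mk_eq_mk.2 (Filter.EventuallyLE.antisymm h h')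

/-- Union, intersection and complement of classes of measurable sets. -/
instance : BooleanAlgebra (MeasAlg μ) where
  sup := Quotient.map₂ (fun s t => ⟨s.1 ∪ t.1, s.2.union t.2⟩)
    fun _ _ h _ _ h' => Filter.EventuallyEq.union h h'
  inf := Quotient.map₂ (fun s t => ⟨s.1 ∩ t.1, s.2.inter t.2⟩)
    fun _ _ h _ _ h' => Filter.EventuallyEq.inter h h'
  compl := Quotient.map (fun s => ⟨s.1ᶜ, s.2.compl⟩)
    fun _ _ h => Filter.EventuallyEq.compl h
  top := mk μ Set.univ .univ
  bot := mk μ ∅ .empty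
  le_sup_left a b := by
    induction a using ind; induction b using ind
    exact Filter.Eventually.of_forall fun _ h => Or.inl h
  le_sup_right a b := by
    induction a using ind; induction b using ind
    exact Filter.Eventually.of_forall fun _ h => Or.inr h
  sup_le a b c := by
    induction a using ind; induction b using ind; induction c using ind
    intro h h'
    filter_upwards [mk_le_mk.1 h, mk_le_mk.1 h'] with x hx hx' using fun k => k.elim hx hx'
  inf_le_left a b := by
    induction a using ind; induction b using ind
    exact Filter.Eventually.of_forall fun _ h => h.1
  inf_le_right a b := by
    induction a using ind; induction b using ind
    exact Filter.Eventually.of_forall fun _ h => h.2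
  le_inf a b c := by
    induction a using ind; induction b using ind; induction c using ind
    intro h h'
    filter_upwards [mk_le_mk.1 h, mk_le_mk.1 h'] with x hx hx' using fun k => ⟨hx k, hx' k⟩
  le_sup_inf a b c := by
    induction a using ind; induction b using ind; induction c using ind
    exact Filter.Eventually.of_forall fun _ h =>
      h.1.elim Or.inl fun hb => h.2.elim Or.inl fun hc => Or.inr ⟨hb, hc⟩
  inf_compl_le_bot a := by
    induction a using ind
    exact Filter.Eventually.of_forall fun _ h => h.2 h.1
  top_le_sup_compl a := by
    induction a using ind
    exact Filter.Eventually.of_forall fun _ _ => Classical.em _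
  le_top a := by
    induction a using ind
    exact Filter.Eventually.of_forall fun _ _ => trivial
  bot_le a := by
    induction a using ind
    exact Filter.Eventually.of_forall fun _ h => h.elim

/-- Over a `σ`-finite measure every family of measurable sets has a union modulo null sets. -/
theorem exists_isLUB [SigmaFinite μ] (S : Set (MeasAlg μ)) : ∃ a, IsLUB S a := by
  classical
  let 𝒮 : Set (Set Ω) := insert ∅ {s | ∃ hs : MeasurableSet s, mk μ s hs ∈ S}
  have h𝒮 : ∀ s ∈ 𝒮, MeasurableSet s := by
    rintro s (rfl | ⟨hs, -⟩)
    exacts [.empty, hs]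
  let ν := μ.toFinite
  let C : Set (Set Ω) := {t | ∃ f : ℕ → Set Ω, (∀ k, f k ∈ 𝒮) ∧ t = ⋃ k, f k}
  have hCm : ∀ t ∈ C, MeasurableSet t := by
    rintro t ⟨f, hf, rfl⟩
    exact .iUnion fun k => h𝒮 _ (hf k)
  have hCne : (ν '' C).Nonempty := by
    have h : (⋃ _ : ℕ, (∅ : Set Ω)) ∈ C := ⟨fun _ => ∅, fun _ => Or.inl rfl, rfl⟩
    exact ⟨_, _, h, rfl⟩
  obtain ⟨u, -, hu, huC⟩ := exists_seq_tendsto_sSup hCne (OrderTop.bddAbove _)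
  choose t htC htu using huC
  choose f hf hft using htC
  let T := ⋃ k, t k
  have hTC : T ∈ C := by
    refine ⟨fun k => f k.unpair.1 k.unpair.2, fun k => hf _ _, ?_⟩
    ext x
    simp only [T, Set.mem_iUnion, hft]
    constructor
    · rintro ⟨i, j, h⟩
      exact ⟨Nat.pair i j, by simpa using h⟩
    · rintro ⟨k, h⟩
      exact ⟨_, _, h⟩
  have hTmax : ∀ t' ∈ C, ν t' ≤ ν T := by
    intro t' ht'
    refine (le_sSup (Set.mem_image_of_mem ν ht')).trans (le_of_tendsto' hu fun k => ?_)
    rw [← htu]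
    exact measure_mono (Set.subset_iUnion t k)
  refine ⟨mk μ T (hCm T hTC), ?_, ?_⟩
  · intro a ha
    induction a using ind with
    | h s hs =>
    have hsT : s ∪ T ∈ C := by
      obtain ⟨g, hg, hgT⟩ := hTC
      refine ⟨cons s g, ?_, ?_⟩
      · rintro (_ | k)
        exacts [Or.inr ⟨hs, ha⟩, hg k]
      · rw [hgT]
        ext x
        simp only [Set.mem_union, Set.mem_iUnion]
        constructor
        · rintro (h | ⟨k, h⟩)
          exacts [⟨0, h⟩, ⟨k + 1, h⟩]
        · rintro ⟨_ | k, h⟩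
          exacts [Or.inl h, Or.inr ⟨k, h⟩]
    have h1 : T =ᵐ[ν] (s ∪ T : Set Ω) :=
      ae_eq_of_subset_of_measure_ge Set.subset_union_right (hTmax _ hsT)
        (hCm T hTC).nullMeasurableSet (measure_ne_top _ _)
    have h2 : T =ᵐ[μ] (s ∪ T : Set Ω) := by
      have h3 : ae ν = ae μ := ae_toFinite
      rwa [h3] at h1
    refine mk_le_mk.2 (Filter.EventuallyLE.trans ?_ h2.symm.le)
    exact Filter.Eventually.of_forall fun _ h => Or.inl h
  · intro b hb
    induction b using ind with
    | h v hv =>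
    obtain ⟨g, hg, hgT⟩ := hTC
    have key : ∀ k, g k ≤ᵐ[μ] v := by
      intro k
      rcases hg k with h | ⟨hs, h⟩
      · rw [h]
        exact Filter.Eventually.of_forall fun _ h => h.elim
      · exact mk_le_mk.1 (hb h)
    refine mk_le_mk.2 ?_
    filter_upwards [ae_all_iff.2 key] with x hx h
    rw [hgT] at h
    obtain ⟨k, hk⟩ := Set.mem_iUnion.1 h
    exact hx k hk

/-- The measurable sets modulo null sets of a `σ`-finite measure form a complete Boolean algebra:
arbitrary unions and intersections are suprema and infima. -/
noncomputable instance [SigmaFinite μ] : CompleteBooleanAlgebra (MeasAlg μ) where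
  __ := (inferInstance : BooleanAlgebra (MeasAlg μ))
  sSup S := (exists_isLUB S).choose
  sInf S := (exists_isLUB (lowerBounds S)).choose
  isLUB_sSup S := (exists_isLUB S).choose_spec
  isGLB_sInf S := isLUB_lowerBounds.1 (exists_isLUB (lowerBounds S)).choose_spec

end MeasAlg

/-! ## The conditional natural numbers and their conditional power set -/

/-- `L⁰(ℕ)`: measurable `ℕ`-valued functions modulo almost everywhere equality. The operations
`0`, `1`, `+`, `·` are the pointwise ones. -/
abbrev L0 (μ : Measure Ω) : Type _ := Ω →ₘ[μ] ℕ

variable {μ : Measure Ω}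

/-- The class of `{ω | n ω = m ω}`. -/
noncomputable def eqSet (n m : L0 μ) : MeasAlg μ :=
  .mk μ {ω | n ω = m ω} (measurableSet_eq_fun n.measurable m.measurable)

/-- The class of `{ω | n ω < m ω}`. -/
noncomputable def ltSet (n m : L0 μ) : MeasAlg μ :=
  .mk μ {ω | n ω < m ω} (measurableSet_lt n.measurable m.measurable)

/-- Two elements of `L⁰(ℕ)` have the same restriction to `A` if they agree almost everywhere
on `A`. -/
def restrSetoid (A : MeasAlg μ) : Setoid (L0 μ) where
  r n m := A ≤ eqSet n m
  iseqv := by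
    induction A using MeasAlg.ind with
    | h s hs =>
    refine ⟨fun n => ?_, fun {n m} h => ?_, fun {n m k} h h' => ?_⟩
    · exact Filter.Eventually.of_forall fun _ _ => rfl
    · filter_upwards [MeasAlg.mk_le_mk.1 h] with ω hω hs using (hω hs).symm
    · filter_upwards [MeasAlg.mk_le_mk.1 h, MeasAlg.mk_le_mk.1 h'] with ω hω hω' hs
        using (hω hs).trans (hω' hs)

/-- The restrictions `n|A` of the elements `n` of `L⁰(ℕ)` to `A`. -/
def Restr (A : MeasAlg μ) : Type _ := Quotient (restrSetoid A)

/-- The restriction `n|A`. -/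
def restr (A : MeasAlg μ) (n : L0 μ) : Restr A := Quotient.mk (restrSetoid A) n

/-- The further restriction of `n|A` to `A' ⊆ A`. -/
def Restr.res {A A' : MeasAlg μ} (h : A' ≤ A) : Restr A → Restr A' :=
  Quotient.map' (s₁ := restrSetoid A) (s₂ := restrSetoid A') id fun _ _ hnm => le_trans h hnm

/-- `N|A = {n|A : n ∈ N}`. -/
def restrSet (A : MeasAlg μ) (N : Set (L0 μ)) : Set (Restr A) := restr A '' N

variable [SigmaFinite μ]

/-- `(A k)` is a measurable partition of `Ω`, up to null sets; parts may be empty. -/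
def IsPartition (A : ℕ → MeasAlg μ) : Prop :=
  Pairwise (fun j k => Disjoint (A j) (A k)) ∧ ⨆ k, A k = ⊤

/-- `x = ∑ₖ nₖ|Aₖ`, that is, `x|Aₖ = nₖ|Aₖ` for all `k`. -/
def IsConcat (A : ℕ → MeasAlg μ) (n : ℕ → L0 μ) (x : L0 μ) : Prop :=
  ∀ k, restr (A k) x = restr (A k) (n k)

/-- A set is stable if it is non-empty and contains all concatenations of its elements along
measurable partitions. -/
def Stable (N : Set (L0 μ)) : Prop :=
  N.Nonempty ∧ ∀ (A : ℕ → MeasAlg μ) (n : ℕ → L0 μ) (x : L0 μ),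
    IsPartition A → (∀ k, n k ∈ N) → IsConcat A n x → x ∈ N

variable (μ) in
/-- The conditional power set of `L⁰(ℕ)`: its elements are the sets `N|A` with `N` stable. -/
structure CondPow where
  /-- The set `A` on which the elements of `N|A` are defined. -/
  dom : MeasAlg μ
  /-- The set `N|A` itself. -/
  carrier : Set (Restr dom)
  exists_stable : ∃ N : Set (L0 μ), Stable N ∧ carrier = restrSet dom N

/-- The conditional element relation `i(n, N|A) = ⋃ {A' ⊆ A : n|A' ∈ N|A'}`; the set `N|A'` is the
set of restrictions to `A'` of the elements of `N|A`. -/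
noncomputable def elemSet (n : L0 μ) (X : CondPow μ) : MeasAlg μ :=
  sSup {A' | ∃ h : A' ≤ X.dom, restr A' n ∈ Restr.res h '' X.carrier}

/-! ## Conditional evaluation -/

/-- The evaluation of a term under an assignment of the number variables. -/
noncomputable def Term.eval (b : ℕ → L0 μ) : Term → L0 μ
  | var k => b k
  | zero => 0
  | one => 1
  | add s t => s.eval b + t.eval b
  | mul s t => s.eval b * t.eval b

/-- The conditional truth value of a formula under the conditional assignment that consists of
`b` for the number variables and `B` for the set variables. -/
noncomputable def Formula.eval : Formula → (ℕ → L0 μ) → (ℕ → CondPow μ) → MeasAlg μ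
  | eq s t, b, _ => eqSet (s.eval b) (t.eval b)
  | lt s t, b, _ => ltSet (s.eval b) (t.eval b)
  | mem t X, b, B => elemSet (t.eval b) (B X)
  | neg φ, b, B => (φ.eval b B)ᶜ
  | and φ ψ, b, B => φ.eval b B ⊓ ψ.eval b B
  | or φ ψ, b, B => φ.eval b B ⊔ ψ.eval b B
  | imp φ ψ, b, B => (φ.eval b B)ᶜ ⊔ ψ.eval b B
  | allN φ, b, B => ⨅ n : L0 μ, φ.eval (cons n b) B
  | exN φ, b, B => ⨆ n : L0 μ, φ.eval (cons n b) B
  | allS φ, b, B => ⨅ X : CondPow μ, φ.eval b (cons X B)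
  | exS φ, b, B => ⨆ X : CondPow μ, φ.eval b (cons X B)

end CondArith

open MeasureTheory

namespace CondArith

/-! ## The measure algebra and the conditional natural numbers -/

section MeasureAlgebra

variable {Ω : Type*} [MeasurableSpace Ω] {μ : Measure Ω}

namespace MeasAlg

/-! The evaluation is a Boolean-valued semantics, so the proof is a soundness proof in two halves.

Logic: in every derivable sequent the meet of the values on the left lies below the join of the
values on the right (`Derivable.conj_le_disj`). Each rule becomes a Boolean law; the eigenvariable
rules need the infinite distributive laws of a complete Boolean algebra, and the quantifier rules
with instances need that substitution commutes with evaluation (`Formula.eval_subst`).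

Axioms: the basic axioms hold pointwise almost everywhere. The other two rest on locality: truth
values on a set depend only on the restrictions of the number arguments to that set
(`eqSet_elemSet`, `Formula.inf_eval_le`). Every `n` in `L⁰(ℕ)` is constant on each piece of a
countable partition, so induction reduces to ordinary induction over constants
(`elemSet_induction`). For comprehension, each local function into the measure algebra is the
membership function of a conditional set (`IsLocal.exists_elemSet_eq`). Non-emptiness of the stable
set behind it comes from the fact that a local function attains its supremum
(`IsLocal.exists_eq_iSup`). -/

theorem mk_inf {s t : Set Ω} (hs : MeasurableSet s) (ht : MeasurableSet t) :
    mk μ s hs ⊓ mk μ t ht = mk μ (s ∩ t) (hs.inter ht) := rfl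

theorem mk_univ : mk μ Set.univ .univ = ⊤ := rfl

theorem mk_eq_top {s : Set Ω} {hs : MeasurableSet s} :
    mk μ s hs = ⊤ ↔ ∀ᵐ ω ∂μ, ω ∈ s := by
  rw [← mk_univ, mk_eq_mk, Filter.eventuallyEq_univ]
  rfl

/-- Countably many exceptional null sets still form a null set, so countable suprema, unlike
arbitrary ones, can be computed on representatives. -/
theorem mk_iUnion [SigmaFinite μ] {s : ℕ → Set Ω} (hs : ∀ k, MeasurableSet (s k)) :
    mk μ (⋃ k, s k) (.iUnion hs) = ⨆ k, mk μ (s k) (hs k) := by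
  apply le_antisymm
  · have h : ∀ k, mk μ (s k) (hs k) ≤ ⨆ k, mk μ (s k) (hs k) := le_iSup _
    -- The supremum has no explicit representative; only its being an upper bound matters, and an
    -- arbitrary upper bound can be represented by a set.
    generalize (⨆ k, mk μ (s k) (hs k)) = a at h
    induction a using ind with
    | h t ht =>
    refine mk_le_mk.2 ?_
    filter_upwards [ae_all_iff.2 fun k => mk_le_mk.1 (h k)] with ω hω hmem
    obtain ⟨k, hk⟩ := Set.mem_iUnion.1 hmem
    exact hω k hk
  · exact iSup_le fun k => mk_le_mk.2 (Filter.Eventually.of_forall fun _ h =>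
      Set.mem_iUnion.2 ⟨k, h⟩)

end MeasAlg

/-! ### Equality as a truth value: equivalence and congruence laws -/

theorem eqSet_refl (n : L0 μ) : eqSet n n = ⊤ :=
  MeasAlg.mk_eq_top.2 (Filter.Eventually.of_forall fun _ => rfl)

theorem eqSet_symm (n m : L0 μ) : eqSet n m = eqSet m n :=
  MeasAlg.mk_eq_mk.2 (Filter.Eventually.of_forall fun _ => propext eq_comm)

theorem eqSet_trans (n m k : L0 μ) : eqSet n m ⊓ eqSet m k ≤ eqSet n k :=
  Filter.Eventually.of_forall fun _ h => Eq.trans h.1 h.2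

theorem eqSet_add (n n' m m' : L0 μ) :
    eqSet n n' ⊓ eqSet m m' ≤ eqSet (n + m) (n' + m') := by
  refine MeasAlg.mk_le_mk.2 ?_
  filter_upwards [AEEqFun.coeFn_add n m, AEEqFun.coeFn_add n' m'] with ω h h' hω
  have h₁ : n ω = n' ω := hω.1
  have h₂ : m ω = m' ω := hω.2
  change (n + m) ω = (n' + m') ω
  rw [h, h', Pi.add_apply, Pi.add_apply, h₁, h₂]

theorem eqSet_mul (n n' m m' : L0 μ) :
    eqSet n n' ⊓ eqSet m m' ≤ eqSet (n * m) (n' * m') := by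
  refine MeasAlg.mk_le_mk.2 ?_
  filter_upwards [AEEqFun.coeFn_mul n m, AEEqFun.coeFn_mul n' m'] with ω h h' hω
  have h₁ : n ω = n' ω := hω.1
  have h₂ : m ω = m' ω := hω.2
  change (n * m) ω = (n' * m') ω
  rw [h, h', Pi.mul_apply, Pi.mul_apply, h₁, h₂]

theorem eqSet_eqSet (n n' m m' : L0 μ) :
    eqSet n n' ⊓ (eqSet m m' ⊓ eqSet n m) ≤ eqSet n' m' :=
  Filter.Eventually.of_forall fun _ h => (Eq.symm h.1).trans (Eq.trans h.2.2 h.2.1)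

theorem eqSet_ltSet (n n' m m' : L0 μ) :
    eqSet n n' ⊓ (eqSet m m' ⊓ ltSet n m) ≤ ltSet n' m' := by
  refine Filter.Eventually.of_forall fun ω h => ?_
  have h₁ : n ω = n' ω := h.1
  have h₂ : m ω = m' ω := h.2.1
  have h₃ : n ω < m ω := h.2.2
  change n' ω < m' ω
  rwa [← h₁, ← h₂]

theorem restr_eq_restr {A : MeasAlg μ} {n m : L0 μ} :
    restr A n = restr A m ↔ A ≤ eqSet n m :=
  ⟨fun h => Quotient.exact h, fun h => Quotient.sound h⟩

/-- The element of `L⁰(ℕ)` that equals `n` on `A` and `m` off `A`. -/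
theorem exists_glue (A : MeasAlg μ) (n m : L0 μ) :
    ∃ x : L0 μ, A ≤ eqSet x n ∧ Aᶜ ≤ eqSet x m := by
  classical
  induction A using MeasAlg.ind with
  | h s hs =>
  have hmeas : Measurable (s.piecewise n m) := n.measurable.piecewise hs m.measurable
  refine ⟨AEEqFun.mk _ hmeas.aestronglyMeasurable, ?_, ?_⟩
  · refine MeasAlg.mk_le_mk.2 ?_
    filter_upwards [AEEqFun.coeFn_mk _ hmeas.aestronglyMeasurable (μ := μ)] with ω h hω
    exact h.trans (Set.piecewise_eq_of_mem _ _ _ hω)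
  · refine MeasAlg.mk_le_mk.2 ?_
    filter_upwards [AEEqFun.coeFn_mk _ hmeas.aestronglyMeasurable (μ := μ)] with ω h hω
    exact h.trans (Set.piecewise_eq_of_notMem _ _ _ hω)

theorem const_add_one (k : ℕ) :
    (AEEqFun.const Ω k + 1 : L0 μ) = AEEqFun.const Ω (k + 1) := by
  apply AEEqFun.ext
  filter_upwards [AEEqFun.coeFn_add (AEEqFun.const Ω k : L0 μ) 1,
    AEEqFun.coeFn_const (μ := μ) Ω k, AEEqFun.coeFn_const (μ := μ) Ω (k + 1),
    AEEqFun.coeFn_one (α := Ω) (μ := μ) (β := ℕ)] with ω h h₁ h₂ h₃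
  rw [h, Pi.add_apply, h₁, h₂, h₃]
  rfl

/-! ## Evaluation of terms -/

theorem comp_cons {α β : Type*} (g : α → β) (a : α) (f : ℕ → α) :
    (fun k => g (cons a f k)) = cons (g a) fun k => g (f k) := by
  funext k
  cases k <;> rfl

theorem Term.eval_subst (b : ℕ → L0 μ) (σ : ℕ → Term) (t : Term) :
    (t.subst σ).eval b = t.eval fun k => (σ k).eval b := by
  induction t with
  | var k => rfl
  | zero => rfl
  | one => rfl
  | add s t hs ht => simp only [Term.subst, Term.eval, hs, ht]
  | mul s t hs ht => simp only [Term.subst, Term.eval, hs, ht]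

theorem Term.eval_shift (n : L0 μ) (b : ℕ → L0 μ) (t : Term) :
    t.shift.eval (cons n b) = t.eval b :=
  t.eval_subst _ _

theorem Term.le_eqSet_eval {a : MeasAlg μ} {b b' : ℕ → L0 μ} (h : ∀ k, a ≤ eqSet (b k) (b' k))
    (t : Term) : a ≤ eqSet (t.eval b) (t.eval b') := by
  induction t with
  | var k => exact h k
  | zero => exact le_top.trans (eqSet_refl _).ge
  | one => exact le_top.trans (eqSet_refl _).ge
  | add s t hs ht => exact (le_inf hs ht).trans (eqSet_add _ _ _ _)
  | mul s t hs ht => exact (le_inf hs ht).trans (eqSet_mul _ _ _ _)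

/-! ## Constants and selectors -/

variable [SigmaFinite μ]

/-- At almost every point `n` has some natural number as its value, so the fibres of `n` cover the
space. -/
theorem iSup_eqSet_const (n : L0 μ) : ⨆ k : ℕ, eqSet n (AEEqFun.const Ω k) = ⊤ := by
  unfold eqSet
  rw [← MeasAlg.mk_iUnion, MeasAlg.mk_eq_top]
  filter_upwards [ae_all_iff.2 fun k : ℕ => AEEqFun.coeFn_const (μ := μ) Ω k] with ω h
  exact Set.mem_iUnion.2 ⟨n ω, by simpa using (h (n ω)).symm⟩

/-- To bound an element it suffices to bound its parts on which `n` is constant. -/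
theorem le_of_inf_eqSet_const_le {a c : MeasAlg μ} (n : L0 μ)
    (h : ∀ k : ℕ, a ⊓ eqSet n (AEEqFun.const Ω k) ≤ c) : a ≤ c := by
  rw [← inf_top_eq a, ← iSup_eqSet_const n, inf_iSup_eq]
  exact iSup_le h

/-- A sequence of sets has a measurable selector of the least index. -/
theorem exists_selector (A : ℕ → MeasAlg μ) :
    ∃ m : L0 μ, ∀ k, (⨆ j, A j) ⊓ eqSet m (AEEqFun.const Ω k) ≤ A k := by
  classical
  have hA : ∀ k, ∃ s, ∃ hs : MeasurableSet s, MeasAlg.mk μ s hs = A k := fun k => by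
    induction A k using MeasAlg.ind with
    | h s hs => exact ⟨s, hs, rfl⟩
  choose s hs hsA using hA
  obtain rfl : (fun k => MeasAlg.mk μ (s k) (hs k)) = A := funext hsA
  -- The second alternative makes the search succeed everywhere: off the union it stops at `0`, and
  -- on the union it is impossible.
  have hex : ∀ ω, ∃ k, ω ∈ s k ∨ ω ∉ ⋃ j, s j := fun ω => by
    by_cases h : ω ∈ ⋃ j, s j
    · obtain ⟨k, hk⟩ := Set.mem_iUnion.1 h
      exact ⟨k, Or.inl hk⟩
    · exact ⟨0, Or.inr h⟩
  have hmeas : Measurable fun ω => Nat.find (hex ω) :=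
    measurable_find hex fun k => (hs k).union (MeasurableSet.iUnion hs).compl
  refine ⟨AEEqFun.mk _ hmeas.aestronglyMeasurable, fun k => ?_⟩
  rw [← MeasAlg.mk_iUnion, eqSet, MeasAlg.mk_inf, MeasAlg.mk_le_mk]
  filter_upwards [AEEqFun.coeFn_mk _ hmeas.aestronglyMeasurable (μ := μ),
    AEEqFun.coeFn_const (μ := μ) Ω k] with ω h h' hω
  have hk : Nat.find (hex ω) = k := by
    rw [← h]
    exact Eq.trans hω.2 h'
  exact hk ▸ (Nat.find_spec (hex ω)).resolve_right fun hn => hn hω.1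

/-! ## The conditional element relation -/

/-- Locality of membership: a set witnessing membership of `n`, cut down to where `n` and `m` agree,
witnesses membership of `m`. -/
theorem eqSet_elemSet (n m : L0 μ) (X : CondPow μ) :
    eqSet n m ⊓ elemSet n X ≤ elemSet m X := by
  rw [elemSet, inf_sSup_eq]
  refine iSup₂_le fun A' ⟨hA', x, hx, hxn⟩ => ?_
  refine le_sSup ⟨inf_le_right.trans hA', x, hx, ?_⟩
  induction x using Quotient.inductionOn with
  | h y =>
  have h : A' ≤ eqSet y n := restr_eq_restr.1 hxn
  refine restr_eq_restr.2 ?_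
  exact (le_inf (inf_le_right.trans h) inf_le_left).trans (eqSet_trans y n m)

/-- A function `f` from `L⁰(ℕ)` to the measure algebra is local if its value depends, on every set
`A`, only on the restriction of the argument to `A`. -/
def IsLocal (f : L0 μ → MeasAlg μ) : Prop :=
  ∀ n m, eqSet n m ⊓ f n ≤ f m

/-- By locality the constants already exhaust the supremum. Choosing measurably, at each point, an
index whose constant does the job there gives one argument that attains it. -/
theorem IsLocal.exists_eq_iSup {f : L0 μ → MeasAlg μ} (hf : IsLocal f) :
    ∃ m, f m = ⨆ n, f n := by
  obtain ⟨m, hm⟩ := exists_selector fun k => f (AEEqFun.const Ω k)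
  refine ⟨m, le_antisymm (le_iSup f m) ?_⟩
  have hconst : ⨆ n, f n ≤ ⨆ k : ℕ, f (AEEqFun.const Ω k) := iSup_le fun n =>
    le_of_inf_eqSet_const_le n fun k => by
      rw [inf_comm]
      exact (hf n _).trans (le_iSup (fun k : ℕ => f (AEEqFun.const Ω k)) k)
  refine hconst.trans (le_of_inf_eqSet_const_le m fun k => ?_)
  refine le_trans (le_inf ?_ (hm k)) (hf (AEEqFun.const Ω k) m)
  rw [eqSet_symm]
  exact inf_le_right

/-- Local functions are the conditional characteristic functions of conditional sets. -/
theorem IsLocal.exists_elemSet_eq {f : L0 μ → MeasAlg μ} (hf : IsLocal f) :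
    ∃ X : CondPow μ, ∀ n, elemSet n X = f n := by
  obtain ⟨m₀, hm₀⟩ := hf.exists_eq_iSup
  -- The conditional set lives on the largest value of `f` and consists of the elements at which `f`
  -- takes that value; `m₀` shows that there are some.
  let D : MeasAlg μ := ⨆ n, f n
  let N : Set (L0 μ) := {n | D ≤ f n}
  have hN : Stable N := by
    refine ⟨⟨m₀, hm₀.ge⟩, fun A n x hA hn hx => ?_⟩
    change D ≤ f x
    rw [← inf_top_eq D, ← hA.2, inf_iSup_eq]
    refine iSup_le fun k => ?_
    refine le_trans (le_inf (inf_le_right.trans ?_) (inf_le_left.trans (hn k))) (hf (n k) x)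
    rw [eqSet_symm]
    exact restr_eq_restr.1 (hx k)
  refine ⟨⟨D, restrSet D N, N, hN, rfl⟩, fun n => le_antisymm ?_ ?_⟩
  -- If `n` agrees on `A'` with some `m` in `N`, then `A' ≤ D ≤ f m`, and locality carries this over
  -- to `f n`.
  · refine sSup_le ?_
    rintro A' ⟨hA', -, ⟨m, hm, rfl⟩, hmn⟩
    exact (le_inf (restr_eq_restr.1 hmn) (hA'.trans hm)).trans (hf m n)
  -- `n` itself need not lie in `N`. Replacing it by `m₀` off `f n` gives a member `x` of `N` that
  -- agrees with `n` on `f n`, so `f n` is one of the sets in the supremum defining membership.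
  · obtain ⟨x, hx, hx'⟩ := exists_glue (f n) n m₀
    have hxN : D ≤ f x := by
      rw [← inf_top_eq D, ← sup_compl_eq_top (x := f n), inf_sup_left]
      refine sup_le ?_ ?_
      · refine le_trans (le_inf (inf_le_right.trans ?_) inf_le_right) (hf n x)
        rwa [eqSet_symm]
      · refine le_trans (le_inf (inf_le_right.trans ?_) (inf_le_left.trans hm₀.ge)) (hf m₀ x)
        rwa [eqSet_symm]
    exact le_sSup ⟨le_iSup f n, restr D x, ⟨x, hxN, rfl⟩, restr_eq_restr.2 hx⟩

/-- Here `c` is the truth value of the induction hypotheses. Ordinary induction settles the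
constants, and locality of membership passes to `n` on each of its fibres. -/
theorem elemSet_induction (X : CondPow μ) {c : MeasAlg μ} (h₀ : c ≤ elemSet 0 X)
    (h₁ : ∀ n : L0 μ, c ≤ (elemSet n X)ᶜ ⊔ elemSet (n + 1) X) (n : L0 μ) :
    c ≤ elemSet n X := by
  have hconst : ∀ k : ℕ, c ≤ elemSet (AEEqFun.const Ω k) X := by
    intro k
    induction k with
    | zero => exact h₀
    | succ k ih =>
      have h := le_inf ih (h₁ (AEEqFun.const Ω k))
      rw [inf_sup_left, inf_compl_eq_bot, bot_sup_eq, const_add_one] at h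
      exact h.trans inf_le_right
  refine le_of_inf_eqSet_const_le n fun k => ?_
  rw [eqSet_symm, inf_comm]
  exact (inf_le_inf_left _ (hconst k)).trans (eqSet_elemSet _ _ X)

/-! ## Substitution and locality of the evaluation of formulas -/

theorem Formula.eval_subst (φ : Formula) (σ : ℕ → Term) (τ : ℕ → ℕ) (b : ℕ → L0 μ)
    (B : ℕ → CondPow μ) :
    (φ.subst σ τ).eval b B = φ.eval (fun k => (σ k).eval b) fun k => B (τ k) := by
  -- Lifting a substitution under a number quantifier matches extending the assignment by the bound
  -- value; `hS` is the same for set quantifiers.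
  have hN (σ : ℕ → Term) (b : ℕ → L0 μ) (n : L0 μ) :
      (fun k => ((cons (.var 0) fun k => (σ k).shift : ℕ → Term) k).eval (cons n b))
        = cons n fun k => (σ k).eval b := by
    rw [comp_cons (Term.eval (cons n b))]
    simp only [Term.eval_shift]
    rfl
  have hS (τ : ℕ → ℕ) (B : ℕ → CondPow μ) (X : CondPow μ) :
      (fun k => cons X B ((cons 0 fun k => τ k + 1 : ℕ → ℕ) k)) = cons X fun k => B (τ k) :=
    comp_cons (cons X B) _ _
  induction φ generalizing σ τ b B with
  | eq s t => simp only [Formula.subst, Formula.eval, Term.eval_subst]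
  | lt s t => simp only [Formula.subst, Formula.eval, Term.eval_subst]
  | mem t X => simp only [Formula.subst, Formula.eval, Term.eval_subst]
  | neg φ ih => simp only [Formula.subst, Formula.eval, ih]
  | and φ ψ ih ih' => simp only [Formula.subst, Formula.eval, ih, ih']
  | or φ ψ ih ih' => simp only [Formula.subst, Formula.eval, ih, ih']
  | imp φ ψ ih ih' => simp only [Formula.subst, Formula.eval, ih, ih']
  | allN φ ih => simp only [Formula.subst, Formula.eval, ih, hN]
  | exN φ ih => simp only [Formula.subst, Formula.eval, ih, hN]
  | allS φ ih => simp only [Formula.subst, Formula.eval, ih, hS]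
  | exS φ ih => simp only [Formula.subst, Formula.eval, ih, hS]

theorem Formula.eval_instN (φ : Formula) (t : Term) (b : ℕ → L0 μ) (B : ℕ → CondPow μ) :
    (φ.instN t).eval b B = φ.eval (cons (t.eval b) b) B := by
  rw [Formula.instN, Formula.eval_subst, comp_cons (Term.eval b)]
  rfl

theorem Formula.eval_instS (φ : Formula) (Y : ℕ) (b : ℕ → L0 μ) (B : ℕ → CondPow μ) :
    (φ.instS Y).eval b B = φ.eval b (cons (B Y) B) := by
  rw [Formula.instS, Formula.eval_subst, comp_cons B]
  rfl

theorem Formula.eval_shiftN (φ : Formula) (n : L0 μ) (b : ℕ → L0 μ) (B : ℕ → CondPow μ) :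
    φ.shiftN.eval (cons n b) B = φ.eval b B :=
  φ.eval_subst _ _ _ _

theorem Formula.eval_shiftS (φ : Formula) (X : CondPow μ) (b : ℕ → L0 μ) (B : ℕ → CondPow μ) :
    φ.shiftS.eval b (cons X B) = φ.eval b B :=
  φ.eval_subst _ _ _ _

/-- On a set on which two assignments agree, a formula has the same truth value under both. -/
theorem Formula.inf_eval_le (φ : Formula) {a : MeasAlg μ} {b b' : ℕ → L0 μ}
    (h : ∀ k, a ≤ eqSet (b k) (b' k)) (B : ℕ → CondPow μ) :
    a ⊓ φ.eval b B ≤ φ.eval b' B := by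
  have hcons {b b' : ℕ → L0 μ} (h : ∀ k, a ≤ eqSet (b k) (b' k)) (n : L0 μ) (k : ℕ) :
      a ≤ eqSet (cons n b k) (cons n b' k) := by
    cases k with
    | zero => exact le_top.trans (eqSet_refl _).ge
    | succ k => exact h k
  -- Complement reverses the inequality, so the inductive hypothesis is needed with the two
  -- assignments exchanged; `eqSet_symm` permits this.
  have hneg {x y : MeasAlg μ} (hxy : a ⊓ y ≤ x) : a ⊓ xᶜ ≤ yᶜ := by
    rw [le_compl_iff_disjoint_right, disjoint_iff_inf_le, inf_right_comm]
    exact (inf_le_inf_right _ hxy).trans inf_compl_eq_bot.le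
  induction φ generalizing b b' B with
  | eq s t =>
    exact (le_inf (inf_le_left.trans (s.le_eqSet_eval h))
      (le_inf (inf_le_left.trans (t.le_eqSet_eval h)) inf_le_right)).trans (eqSet_eqSet _ _ _ _)
  | lt s t =>
    exact (le_inf (inf_le_left.trans (s.le_eqSet_eval h))
      (le_inf (inf_le_left.trans (t.le_eqSet_eval h)) inf_le_right)).trans (eqSet_ltSet _ _ _ _)
  | mem t X => exact (inf_le_inf_right _ (t.le_eqSet_eval h)).trans (eqSet_elemSet _ _ _)
  | neg φ ih => exact hneg (ih (fun k => (h k).trans (eqSet_symm _ _).le) B)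
  | and φ ψ ih ih' =>
    exact le_inf ((inf_le_inf_left a inf_le_left).trans (ih h B))
      ((inf_le_inf_left a inf_le_right).trans (ih' h B))
  | or φ ψ ih ih' =>
    simp only [Formula.eval, inf_sup_left]
    exact sup_le_sup (ih h B) (ih' h B)
  | imp φ ψ ih ih' =>
    simp only [Formula.eval, inf_sup_left]
    exact sup_le_sup (hneg (ih (fun k => (h k).trans (eqSet_symm _ _).le) B)) (ih' h B)
  | allN φ ih =>
    exact le_iInf fun n => (inf_le_inf_left a (iInf_le _ n)).trans (ih (hcons h n) B)
  | exN φ ih =>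
    simp only [Formula.eval, inf_iSup_eq]
    exact iSup_mono fun n => ih (hcons h n) B
  | allS φ ih =>
    exact le_iInf fun X => (inf_le_inf_left a (iInf_le _ X)).trans (ih h (cons X B))
  | exS φ ih =>
    simp only [Formula.eval, inf_iSup_eq]
    exact iSup_mono fun X => ih h (cons X B)

/-- The input for comprehension: changing only the number variable `0` leaves two assignments that
agree wherever its two values do. -/
theorem Formula.isLocal_eval (φ : Formula) (b : ℕ → L0 μ) (B : ℕ → CondPow μ) :
    IsLocal fun n => φ.eval (cons n b) B := fun n m => by
  refine φ.inf_eval_le (fun k => ?_) B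
  cases k with
  | zero => exact le_rfl
  | succ k => exact le_top.trans (eqSet_refl _).ge

/-! ## Soundness of the sequent calculus -/

/-- The truth value of the conjunction of a list of formulas. -/
noncomputable def conj (Γ : List Formula) (b : ℕ → L0 μ) (B : ℕ → CondPow μ) : MeasAlg μ :=
  ⨅ φ ∈ Γ, φ.eval b B

/-- The truth value of the disjunction of a list of formulas. -/
noncomputable def disj (Γ : List Formula) (b : ℕ → L0 μ) (B : ℕ → CondPow μ) : MeasAlg μ :=
  ⨆ φ ∈ Γ, φ.eval b B

section Lists

variable (b : ℕ → L0 μ) (B : ℕ → CondPow μ) (φ : Formula) (Γ Δ : List Formula)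

theorem conj_nil : conj [] b B = ⊤ := by simp [conj]

theorem disj_nil : disj [] b B = ⊥ := by simp [disj]

theorem conj_cons : conj (φ :: Γ) b B = φ.eval b B ⊓ conj Γ b B := by
  simp [conj, iInf_or, iInf_inf_eq]

theorem disj_cons : disj (φ :: Γ) b B = φ.eval b B ⊔ disj Γ b B := by
  simp [disj, iSup_or, iSup_sup_eq]

theorem conj_append : conj (Γ ++ Δ) b B = conj Γ b B ⊓ conj Δ b B := by
  simp [conj, iInf_or, iInf_inf_eq]

theorem disj_append : disj (Γ ++ Δ) b B = disj Γ b B ⊔ disj Δ b B := by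
  simp [disj, iSup_or, iSup_sup_eq]

theorem conj_map_shiftN (n : L0 μ) : conj (Γ.map Formula.shiftN) (cons n b) B = conj Γ b B := by
  induction Γ with
  | nil => simp only [List.map_nil, conj_nil]
  | cons φ Γ ih => rw [List.map_cons, conj_cons, conj_cons, ih, Formula.eval_shiftN]

theorem disj_map_shiftN (n : L0 μ) : disj (Γ.map Formula.shiftN) (cons n b) B = disj Γ b B := by
  induction Γ with
  | nil => simp only [List.map_nil, disj_nil]
  | cons φ Γ ih => rw [List.map_cons, disj_cons, disj_cons, ih, Formula.eval_shiftN]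

theorem conj_map_shiftS (X : CondPow μ) :
    conj (Γ.map Formula.shiftS) b (cons X B) = conj Γ b B := by
  induction Γ with
  | nil => simp only [List.map_nil, conj_nil]
  | cons φ Γ ih => rw [List.map_cons, conj_cons, conj_cons, ih, Formula.eval_shiftS]

theorem disj_map_shiftS (X : CondPow μ) :
    disj (Γ.map Formula.shiftS) b (cons X B) = disj Γ b B := by
  induction Γ with
  | nil => simp only [List.map_nil, disj_nil]
  | cons φ Γ ih => rw [List.map_cons, disj_cons, disj_cons, ih, Formula.eval_shiftS]

end Lists

theorem inf_le_sup_of_cut {α : Type*} [DistribLattice α] {a c d e x : α} (h : a ≤ x ⊔ c)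
    (h' : x ⊓ d ≤ e) : a ⊓ d ≤ c ⊔ e :=
  calc a ⊓ d ≤ (x ⊔ c) ⊓ d := inf_le_inf_right d h
    _ = x ⊓ d ⊔ c ⊓ d := inf_sup_right _ _ _
    _ ≤ e ⊔ c := sup_le_sup h' inf_le_left
    _ = c ⊔ e := sup_comm _ _

theorem Derivable.conj_le_disj {Γ Δ : List Formula} (h : Derivable Γ Δ) (b : ℕ → L0 μ)
    (B : ℕ → CondPow μ) : conj Γ b B ≤ disj Δ b B := by
  induction h generalizing b B with
  | init φ => simp only [conj_cons, disj_cons, conj_nil, disj_nil, inf_top_eq, sup_bot_eq, le_rfl]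
  | eqRefl t =>
    simp only [disj_cons, disj_nil, sup_bot_eq, Formula.eval, eqSet_refl, le_top]
  | eqAdd s s' t t' =>
    simpa only [conj_cons, disj_cons, conj_nil, disj_nil, inf_top_eq, sup_bot_eq, Formula.eval,
      Term.eval] using eqSet_add _ _ _ _
  | eqMul s s' t t' =>
    simpa only [conj_cons, disj_cons, conj_nil, disj_nil, inf_top_eq, sup_bot_eq, Formula.eval,
      Term.eval] using eqSet_mul _ _ _ _
  | eqEq s s' t t' =>
    simpa only [conj_cons, disj_cons, conj_nil, disj_nil, inf_top_eq, sup_bot_eq, Formula.eval]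
      using eqSet_eqSet _ _ _ _
  | eqLt s s' t t' =>
    simpa only [conj_cons, disj_cons, conj_nil, disj_nil, inf_top_eq, sup_bot_eq, Formula.eval]
      using eqSet_ltSet _ _ _ _
  | eqMem s s' X =>
    simpa only [conj_cons, disj_cons, conj_nil, disj_nil, inf_top_eq, sup_bot_eq, Formula.eval]
      using eqSet_elemSet _ _ _
  | weakL φ _ ih =>
    rw [conj_cons]
    exact inf_le_right.trans (ih b B)
  | weakR φ _ ih =>
    rw [disj_cons]
    exact (ih b B).trans le_sup_right
  | contrL _ ih =>
    have := ih b B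
    rwa [conj_cons, conj_cons, ← inf_assoc, inf_idem, ← conj_cons] at this
  | contrR _ ih =>
    have := ih b B
    rwa [disj_cons, disj_cons, ← sup_assoc, sup_idem, ← disj_cons] at this
  | exchL hp _ ih =>
    have := ih b B
    -- The meet is indexed by membership in the list, so a permutation does not change it.
    simpa only [conj, hp.mem_iff] using this
  | exchR hp _ ih =>
    have := ih b B
    simpa only [disj, hp.mem_iff] using this
  | cut _ _ ih ih' =>
    rw [conj_append, disj_append]
    have h := ih b B
    have h' := ih' b B
    rw [disj_cons] at h
    rw [conj_cons] at h'
    exact inf_le_sup_of_cut h h'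
  | negL _ ih =>
    have h := ih b B
    rw [disj_cons] at h
    -- A complement moves across the inequality: `a \ x ≤ c` is equivalent to `a ≤ x ⊔ c`.
    rw [conj_cons, Formula.eval, inf_comm, ← sdiff_eq]
    exact sdiff_le_iff.2 h
  | negR _ ih =>
    have h := ih b B
    rw [conj_cons] at h
    rw [disj_cons, Formula.eval, sup_comm, ← himp_eq, le_himp_iff, inf_comm]
    exact h
  | andL₁ ψ _ ih =>
    have h := ih b B
    rw [conj_cons] at h ⊢
    exact (inf_le_inf_right _ inf_le_left).trans h
  | andL₂ φ _ ih =>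
    have h := ih b B
    rw [conj_cons] at h ⊢
    exact (inf_le_inf_right _ inf_le_right).trans h
  | andR _ _ ih ih' =>
    have h := ih b B
    have h' := ih' b B
    rw [disj_cons] at h h' ⊢
    rw [Formula.eval, sup_inf_right]
    exact le_inf h h'
  | orL _ _ ih ih' =>
    have h := ih b B
    have h' := ih' b B
    rw [conj_cons] at h h' ⊢
    rw [Formula.eval, inf_sup_right]
    exact sup_le h h'
  | orR₁ ψ _ ih =>
    have h := ih b B
    rw [disj_cons] at h ⊢
    exact h.trans (sup_le_sup_right le_sup_left _)
  | orR₂ φ _ ih =>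
    have h := ih b B
    rw [disj_cons] at h ⊢
    exact h.trans (sup_le_sup_right le_sup_right _)
  | impL _ _ ih ih' =>
    have h := ih b B
    have h' := ih' b B
    rw [disj_cons] at h
    rw [conj_cons] at h'
    rw [conj_cons, conj_append, disj_append, Formula.eval, inf_sup_right]
    -- Where the antecedent fails the first premise applies; where the consequent holds, the second.
    refine sup_le ?_ ?_
    · rw [inf_comm, ← sdiff_eq, sdiff_le_iff]
      exact (inf_le_left.trans h).trans (sup_le_sup_left le_sup_left _)
    · exact ((inf_le_inf_left _ inf_le_right).trans h').trans le_sup_right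
  | impR _ ih =>
    have h := ih b B
    rw [conj_cons, disj_cons] at h
    rw [disj_cons, Formula.eval, sup_assoc, sup_comm, ← himp_eq, le_himp_iff, inf_comm]
    exact h
  | allNL t _ ih =>
    have h := ih b B
    rw [conj_cons, Formula.eval_instN] at h
    rw [conj_cons, Formula.eval]
    exact (inf_le_inf_right _ (iInf_le _ _)).trans h
  | allNR _ ih =>
    -- Infinite distributivity reduces the goal to one value `n` of the eigenvariable at a time; the
    -- raised side formulas do not depend on it.
    rw [disj_cons, Formula.eval, iInf_sup_eq]
    refine le_iInf fun n => ?_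
    have h := ih (cons n b) B
    rwa [conj_map_shiftN, disj_cons, disj_map_shiftN] at h
  | exNL _ ih =>
    rw [conj_cons, Formula.eval, iSup_inf_eq]
    refine iSup_le fun n => ?_
    have h := ih (cons n b) B
    rwa [disj_map_shiftN, conj_cons, conj_map_shiftN] at h
  | exNR t _ ih =>
    have h := ih b B
    rw [disj_cons, Formula.eval_instN] at h
    rw [disj_cons, Formula.eval]
    exact h.trans (sup_le_sup_right (le_iSup (fun n => Formula.eval _ (cons n b) B) _) _)
  | allSL Y _ ih =>
    have h := ih b B
    rw [conj_cons, Formula.eval_instS] at h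
    rw [conj_cons, Formula.eval]
    exact (inf_le_inf_right _ (iInf_le _ _)).trans h
  | allSR _ ih =>
    rw [disj_cons, Formula.eval, iInf_sup_eq]
    refine le_iInf fun X => ?_
    have h := ih b (cons X B)
    rwa [conj_map_shiftS, disj_cons, disj_map_shiftS] at h
  | exSL _ ih =>
    rw [conj_cons, Formula.eval, iSup_inf_eq]
    refine iSup_le fun X => ?_
    have h := ih b (cons X B)
    rwa [disj_map_shiftS, conj_cons, conj_map_shiftS] at h
  | exSR Y _ ih =>
    have h := ih b B
    rw [disj_cons, Formula.eval_instS] at h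
    rw [disj_cons, Formula.eval]
    exact h.trans (sup_le_sup_right (le_iSup (fun X => Formula.eval _ b (cons X B)) _) _)

/-! ## The axioms of `ACA₀` -/

theorem Formula.eval_iff_eq_top {φ ψ : Formula} {b : ℕ → L0 μ} {B : ℕ → CondPow μ}
    (h : φ.eval b B = ψ.eval b B) : (φ.iff ψ).eval b B = ⊤ := by
  simp only [Formula.iff, Formula.eval, h, compl_sup_eq_top, inf_top_eq]

theorem ACA0Matrix.eval_eq_top {φ : Formula} (h : ACA0Matrix φ) (b : ℕ → L0 μ)
    (B : ℕ → CondPow μ) : φ.eval b B = ⊤ := by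
  have hone : ∀ᵐ ω ∂μ, (1 : L0 μ) ω = 1 := AEEqFun.coeFn_one
  have hzero : ∀ᵐ ω ∂μ, (0 : L0 μ) ω = 0 := AEEqFun.coeFn_zero
  have hadd (n m : L0 μ) : ∀ᵐ ω ∂μ, (n + m) ω = n ω + m ω := AEEqFun.coeFn_add n m
  have hmul (n m : L0 μ) : ∀ᵐ ω ∂μ, (n * m) ω = n ω * m ω := AEEqFun.coeFn_mul n m
  cases h with
  | succ_ne_zero =>
    refine MeasAlg.mk_eq_top.2 ?_
    filter_upwards [hadd (b 0) 1, hone, hzero] with ω h h₁ h₀ h'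
    have h' : (b 0 + 1) ω = (0 : L0 μ) ω := h'
    omega
  | succ_inj =>
    refine MeasAlg.mk_eq_top.2 ?_
    filter_upwards [hadd (b 0) 1, hadd (b 1) 1] with ω h h'
    refine or_iff_not_imp_left.2 fun h₁ => ?_
    have h₁ : (b 0 + 1) ω = (b 1 + 1) ω := not_not.1 h₁
    change b 0 ω = b 1 ω
    omega
  | add_zero =>
    simp only [Formula.eval, Term.eval, _root_.add_zero, eqSet_refl]
  | add_succ =>
    simp only [Formula.eval, Term.eval, ← add_assoc, eqSet_refl]
  | mul_zero =>
    refine MeasAlg.mk_eq_top.2 ?_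
    filter_upwards [hmul (b 0) 0, hzero] with ω h h₀
    change (b 0 * 0) ω = (0 : L0 μ) ω
    rw [h, h₀, Nat.mul_zero]
  | mul_succ =>
    refine MeasAlg.mk_eq_top.2 ?_
    filter_upwards [hmul (b 0) (b 1 + 1), hadd (b 1) 1, hone, hadd (b 0 * b 1) (b 0),
      hmul (b 0) (b 1)] with ω h₁ h₂ h₃ h₄ h₅
    change (b 0 * (b 1 + 1)) ω = (b 0 * b 1 + b 0) ω
    rw [h₁, h₂, h₃, h₄, h₅, Nat.mul_succ]
  | not_lt_zero =>
    refine MeasAlg.mk_eq_top.2 ?_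
    filter_upwards [hzero] with ω h₀ h'
    have h' : b 0 ω < (0 : L0 μ) ω := h'
    omega
  | lt_succ =>
    refine Formula.eval_iff_eq_top (MeasAlg.mk_eq_mk.2 ?_)
    filter_upwards [hadd (b 1) 1, hone] with ω h h₁
    change (b 0 ω < (b 1 + 1) ω) = (b 0 ω < b 1 ω ∨ b 0 ω = b 1 ω)
    rw [h, h₁, Nat.lt_succ_iff_lt_or_eq]
  | induction =>
    simp only [Formula.eval]
    -- An implication has value `⊤` exactly when the value of its antecedent is at most that of its
    -- consequent.
    rw [sup_comm, ← himp_eq, himp_eq_top_iff]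
    exact le_iInf fun n => elemSet_induction (B 0) inf_le_left
      (fun m => inf_le_right.trans (iInf_le _ m)) n
  | comprehension φ _ =>
    -- One conditional set has the truth value of `φ` at `n` as its membership value for every `n`,
    -- so this single witness already gives the existential the value `⊤`.
    obtain ⟨X, hX⟩ := (φ.isLocal_eval b B).exists_elemSet_eq
    refine top_le_iff.1 (le_iSup_of_le X (le_iInf fun n => ?_))
    refine (Formula.eval_iff_eq_top ?_).ge
    rw [Formula.eval_shiftS]
    exact hX n

theorem ACA0.eval_eq_top {φ : Formula} (h : φ ∈ ACA0) (b : ℕ → L0 μ) (B : ℕ → CondPow μ) :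
    φ.eval b B = ⊤ := by
  induction h generalizing b B with
  | base h => exact h.eval_eq_top b B
  | allN _ ih => exact iInf_eq_top.2 fun n => ih (cons n b) B
  | allS _ ih => exact iInf_eq_top.2 fun X => ih b (cons X B)

end MeasureAlgebra

end CondArith

theorem theorem3 {Ω : Type*} [MeasurableSpace Ω] (μ : MeasureTheory.Measure Ω)
    [MeasureTheory.SigmaFinite μ] (φ : CondArith.Formula)
    (hφ : CondArith.Consequence CondArith.ACA0 φ)
    (b : ℕ → CondArith.L0 μ) (B : ℕ → CondArith.CondPow μ) :
    φ.eval b B = CondArith.MeasAlg.mk μ Set.univ MeasurableSet.univ := by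
  obtain ⟨Γ, hΓ, hder⟩ := hφ
  have h := hder.conj_le_disj b B
  rw [CondArith.disj_cons, CondArith.disj_nil, sup_bot_eq] at h
  rw [CondArith.MeasAlg.mk_univ]
  exact top_le_iff.1 ((le_iInf₂ fun ψ hψ =>
    (CondArith.ACA0.eval_eq_top (hΓ ψ hψ) b B).ge).trans h)
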